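/- Let $\mathcal H_M$ (memory) and $\mathcal H_B$ (bath) be finite-dimensional complex Hilbert spaces with Hamiltonians (Hermitian operators) $H_M$ and $H_B$, let $\beta>0$ be an inverse temperature, let $\rho'_M$ be a quantum state (density operator) on $\mathcal H_M$, and let $\rho'_B=e^{-\beta H_B}/\mathrm{tr}[e^{-\beta H_B}]$ be the thermal state of the bath. Let $U_{MB}$ be a unitary on $\mathcal H_M\otimes\mathcal H_B$, put $$\rho'_{MB}=\rho'_M\otimes\rho'_B,\qquad \rho''_{MB}=U_{MB}\,\rho'_{MB}\,U_{MB}^\dagger,\qquad \rho''_B=\mathrm{tr}_M[\rho''_{MB}],$$ and suppose that this process resets the memory to the state $\rho_M$, i.e. $\mathrm{tr}_B[\rho''_{MB}]=\rho_M$. Write $S(\rho)=-\mathrm{tr}[\rho\ln\rho]$ for the von Neumann entropy and $F_X(\rho)=\mathrm{tr}[H_X\rho]-S(\rho)/\beta$ for the free energy of a state $\rho$ of $X\in\{M,B\}$, and let - $\Delta E_{\mathcal R}=\mathrm{tr}[H_{MB}(\rho''_{MB}-\rho'_{MB})]$, where $H_{MB}=H_M\otimes\mathbb 1+\mathbb 1\otimes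 H_B$, be the energy cost of the reset; - $\Delta F_M=F_M(\rho'_M)-F_M(\rho_M)$ and $\Delta F_B=F_B(\rho''_B)-F_B(\rho'_B)$; - $I(M:B)=S(\rho_M)+S(\rho''_B)-S(\rho''_{MB})$ be the mutual information of the final state $\rho''_{MB}$. Then $$\beta\,\Delta E_{\mathcal R}=-\beta\,\Delta F_M+\beta\,\Delta F_B+I(M:B).$$ Moreover $\Delta F_B=\frac1\beta D(\rho''_B\|\rho'_B)\ge 0$, where $D(\rho\|\sigma)=\mathrm{tr}[\rho(\ln\rho-\ln\sigma)]$ is the quantum relative entropy ($+\infty$ if the support of $\rho$ is not contained in that of $\sigma$), and $I(M:B)\ge 0$, so that $$\Delta E_{\mathcal R}\ge-\Delta F_M.$$ -/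

import Mathlib

open Matrix
open scoped Kronecker ComplexOrder

/-- A quantum state (density matrix) on the finite-dimensional Hilbert space `ℂ^n`. -/
def IsDensityMatrix {n : Type*} [Fintype n] (ρ : Matrix n n ℂ) : Prop :=
  ρ.PosSemidef ∧ ρ.trace = 1

/-- The partial trace over the second factor, `tr_B X`, of an operator on `ℂ^m ⊗ ℂ^b`. -/
def partialTraceSnd {m b : Type*} [Fintype b] (X : Matrix (m × b) (m × b) ℂ) :
    Matrix m m ℂ :=
  Matrix.of fun i j => ∑ k, X (i, k) (j, k)

/-- The partial trace over the first factor, `tr_M X`, of an operator on `ℂ^m ⊗ ℂ^b`. -/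
def partialTraceFst {m b : Type*} [Fintype m] (X : Matrix (m × b) (m × b) ℂ) :
    Matrix b b ℂ :=
  Matrix.of fun i j => ∑ k, X (k, i) (k, j)

/-- The logarithm of a Hermitian matrix through the spectral calculus. The eigenvalue `0` is sent
to `0`, in accordance with the conventions `0 ln 0 = 0` and "`ln` on the support". -/
noncomputable def matrixLog {n : Type*} [Fintype n] [DecidableEq n] (A : Matrix n n ℂ) :
    Matrix n n ℂ :=
  cfc Real.log A

/-- The von Neumann entropy `S(ρ) = -tr[ρ ln ρ]` (a real number for Hermitian `ρ`). -/
noncomputable def vonNeumannEntropy {n : Type*} [Fintype n] [DecidableEq n]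
    (ρ : Matrix n n ℂ) : ℝ :=
  -(ρ * matrixLog ρ).trace.re

/-- The expected energy `tr[H ρ]` (a real number for Hermitian `H` and `ρ`). -/
def expectedEnergy {n : Type*} [Fintype n] (H ρ : Matrix n n ℂ) : ℝ :=
  (H * ρ).trace.re

/-- The free energy `F(ρ) = tr[H ρ] - S(ρ) / β` with respect to the Hamiltonian `H` at inverse
temperature `β`. -/
noncomputable def freeEnergy {n : Type*} [Fintype n] [DecidableEq n] (β : ℝ)
    (H ρ : Matrix n n ℂ) : ℝ :=
  expectedEnergy H ρ - vonNeumannEntropy ρ / β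

/-- The thermal (Gibbs) state `exp(-β H) / tr[exp(-β H)]`. -/
noncomputable def thermalState {n : Type*} [Fintype n] [DecidableEq n] (β : ℝ)
    (H : Matrix n n ℂ) : Matrix n n ℂ :=
  (NormedSpace.exp (-β • H)).trace⁻¹ • NormedSpace.exp (-β • H)

/-- The quantum mutual information `I(M:B) = S(ρ_M) + S(ρ_B) - S(ρ_MB)` of a bipartite state. -/
noncomputable def mutualInformation {m b : Type*} [Fintype m] [DecidableEq m] [Fintype b]
    [DecidableEq b] (ρ : Matrix (m × b) (m × b) ℂ) : ℝ :=
  vonNeumannEntropy (partialTraceSnd ρ) + vonNeumannEntropy (partialTraceFst ρ)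
    - vonNeumannEntropy ρ

open Classical in
/-- The quantum relative entropy `D(ρ‖σ)`: equal to `tr[ρ (ln ρ - ln σ)]` if the support of `ρ` is
contained in that of `σ` (equivalently, `ker σ ⊆ ker ρ`), and to `+∞` otherwise. -/
noncomputable def relativeEntropy {n : Type*} [Fintype n] [DecidableEq n]
    (ρ σ : Matrix n n ℂ) : EReal :=
  if LinearMap.ker σ.mulVecLin ≤ LinearMap.ker ρ.mulVecLin then
    (((ρ * (matrixLog ρ - matrixLog σ)).trace.re : ℝ) : EReal)
  else ⊤

/-- The Hamiltonian `H_M ⊗ 1 + 1 ⊗ H_B` of the two (non-interacting) systems `M` and `B`. -/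
def totalHamiltonian {m b : Type*} [DecidableEq m] [DecidableEq b] (HM : Matrix m m ℂ)
    (HB : Matrix b b ℂ) : Matrix (m × b) (m × b) ℂ :=
  HM ⊗ₖ (1 : Matrix b b ℂ) + (1 : Matrix m m ℂ) ⊗ₖ HB

/-! Without interaction the energy of a joint state depends only on its two marginals
(`expectedEnergy_totalHamiltonian`). Entropy is invariant under unitary conjugation and additive on
products, so the final joint entropy equals the sum of the two initial entropies. Substituting both
facts into the free energies gives the balance as an algebraic identity.

Both signs come from Klein's inequality, `IsDensityMatrix.sum_diag_mul_log_le`. Against the thermal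
state, whose logarithm is affine in the Hamiltonian, it shows that the thermal state minimizes free
energy. Against the product of the marginals it gives subadditivity of entropy. Writing Hermitian
matrices as `spectralAlgHom V q` turns logarithms, exponentials and traces into operations on real
vectors. -/

open Unitary

/-! ### Functional calculus on a fixed eigenbasis -/

section Spectral

variable {n : Type*} [Fintype n] [DecidableEq n]

/-- The matrix `V * diagonal q * Vᴴ` with real eigenvalues `q` in the orthonormal basis formed by
the columns of the unitary `V`, as an algebra homomorphism in `q`. -/
noncomputable def spectralAlgHom (V : unitaryGroup n ℂ) : (n → ℝ) →ₐ[ℝ] Matrix n n ℂ :=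
  ((conjStarAlgAut ℝ (Matrix n n ℂ) V).toAlgEquiv : Matrix n n ℂ →ₐ[ℝ] Matrix n n ℂ).comp
    ((diagonalAlgHom ℝ).comp
      (AlgHom.pi (R := ℝ) (A := fun _ : n => ℂ) fun i => Complex.ofRealAm.comp (Pi.evalAlgHom ℝ _ i)))

theorem spectralAlgHom_apply (V : unitaryGroup n ℂ) (q : n → ℝ) :
    spectralAlgHom V q = (V : Matrix n n ℂ) * diagonal (fun i => (q i : ℂ)) * (V : Matrix n n ℂ)ᴴ :=
  rfl

theorem isHermitian_spectralAlgHom (V : unitaryGroup n ℂ) (q : n → ℝ) :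
    (spectralAlgHom V q).IsHermitian := by
  rw [spectralAlgHom_apply]
  apply isHermitian_mul_mul_conjTranspose
  rw [isHermitian_diagonal_iff]
  intro i
  simp [isSelfAdjoint_iff]

theorem Matrix.IsHermitian.exists_eq_spectralAlgHom {A : Matrix n n ℂ} (hA : A.IsHermitian) :
    ∃ V, A = spectralAlgHom V hA.eigenvalues :=
  ⟨hA.eigenvectorUnitary, hA.spectral_theorem⟩

theorem conjTranspose_mul_self_unitary (V : unitaryGroup n ℂ) :
    (V : Matrix n n ℂ)ᴴ * (V : Matrix n n ℂ) = 1 :=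
  UnitaryGroup.star_mul_self V

theorem trace_spectralAlgHom (V : unitaryGroup n ℂ) (q : n → ℝ) :
    (spectralAlgHom V q).trace = ((∑ i, q i : ℝ) : ℂ) := by
  rw [spectralAlgHom_apply, trace_mul_cycle, conjTranspose_mul_self_unitary, one_mul,
    trace_diagonal, Complex.ofReal_sum]

/-- Polynomials commute with algebra homomorphisms, so `Real.log` is replaced by a Lagrange
interpolant. Its nodes include both the spectrum and the values of `q`, so the two need not be
identified. -/
theorem matrixLog_spectralAlgHom (V : unitaryGroup n ℂ) (q : n → ℝ) :
    matrixLog (spectralAlgHom V q) = spectralAlgHom V (fun i => Real.log (q i)) := by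
  have hA := isHermitian_spectralAlgHom V q
  let s : Finset ℝ := Finset.univ.image q ∪ (finite_real_spectrum (A := spectralAlgHom V q)).toFinset
  let P := Lagrange.interpolate s id Real.log
  have hP : ∀ x ∈ s, P.eval x = Real.log x := fun x hx =>
    Lagrange.eval_interpolate_at_node (v := id) Real.log Function.injective_id.injOn hx
  have h1 : cfc Real.log (spectralAlgHom V q) = cfc P.eval (spectralAlgHom V q) :=
    cfc_congr fun x hx => (hP x (by simp [s, hx])).symm
  rw [matrixLog, h1, cfc_polynomial P _ hA.isSelfAdjoint, Polynomial.aeval_algHom_apply]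
  congr 1
  funext i
  have := Polynomial.aeval_algHom_apply (Pi.evalAlgHom ℝ (fun _ : n => ℝ) i) q P
  simp only [Pi.evalAlgHom_apply, Polynomial.coe_aeval_eq_eval] at this
  rw [← this, hP _ (by simp [s])]

theorem trace_mul_spectralAlgHom (V : unitaryGroup n ℂ) (A : Matrix n n ℂ) (f : n → ℝ) :
    (A * spectralAlgHom V f).trace.re =
      ∑ i, (((V : Matrix n n ℂ)ᴴ * A * V) i i).re * f i := by
  rw [spectralAlgHom_apply, ← Matrix.mul_assoc, trace_mul_comm, ← Matrix.mul_assoc,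
    ← Matrix.mul_assoc, trace, Complex.re_sum]
  simp [mul_diagonal]

theorem vonNeumannEntropy_spectralAlgHom (V : unitaryGroup n ℂ) (q : n → ℝ) :
    vonNeumannEntropy (spectralAlgHom V q) = -∑ i, q i * Real.log (q i) := by
  rw [vonNeumannEntropy, matrixLog_spectralAlgHom, ← map_mul, trace_spectralAlgHom,
    Complex.ofReal_re]
  rfl

theorem exp_spectralAlgHom (V : unitaryGroup n ℂ) (q : n → ℝ) :
    NormedSpace.exp (spectralAlgHom V q) = spectralAlgHom V (fun i => Real.exp (q i)) := by
  have hV : (V : Matrix n n ℂ)⁻¹ = (V : Matrix n n ℂ)ᴴ :=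
    inv_eq_left_inv (conjTranspose_mul_self_unitary V)
  have hu : IsUnit (V : Matrix n n ℂ) := (isUnit_iff_isUnit_det _).2 (UnitaryGroup.det_isUnit V)
  rw [spectralAlgHom_apply, spectralAlgHom_apply, ← hV, exp_conj _ _ hu, exp_diagonal]
  congr 3
  funext i
  rw [Pi.coe_exp, ← Complex.exp_eq_exp_ℂ, Complex.ofReal_exp]

theorem IsDensityMatrix.exists_eq_spectralAlgHom {ρ : Matrix n n ℂ} (hρ : IsDensityMatrix ρ) :
    ∃ V q, ρ = spectralAlgHom V q ∧ (∀ i, 0 ≤ q i) ∧ ∑ i, q i = 1 := by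
  obtain ⟨V, hV⟩ := hρ.1.1.exists_eq_spectralAlgHom
  refine ⟨V, _, hV, hρ.1.eigenvalues_nonneg, ?_⟩
  have h := hρ.2
  rw [hV, trace_spectralAlgHom] at h
  exact_mod_cast h

theorem isDensityMatrix_spectralAlgHom (V : unitaryGroup n ℂ) {q : n → ℝ} (hq : ∀ i, 0 ≤ q i)
    (hsum : ∑ i, q i = 1) : IsDensityMatrix (spectralAlgHom V q) := by
  refine ⟨?_, by rw [trace_spectralAlgHom, hsum, Complex.ofReal_one]⟩
  rw [spectralAlgHom_apply]
  exact (PosSemidef.diagonal fun i => by simpa using hq i).mul_mul_conjTranspose_same _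

theorem conj_spectralAlgHom (U V : unitaryGroup n ℂ) (q : n → ℝ) :
    (U : Matrix n n ℂ) * spectralAlgHom V q * (U : Matrix n n ℂ)ᴴ = spectralAlgHom (U * V) q := by
  simp only [spectralAlgHom_apply, UnitaryGroup.mul_val, conjTranspose_mul, Matrix.mul_assoc]

end Spectral

/-! ### Klein's inequality -/

section Klein

/-- Scalar Klein inequality: `log x ≤ x - 1` at `x = q / p`, multiplied by `p`. -/
theorem sub_le_mul_log_sub_log {p q : ℝ} (hp : 0 ≤ p) (hq : 0 < q) :
    p - q ≤ p * (Real.log p - Real.log q) := by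
  rcases hp.eq_or_lt with rfl | hp
  · simpa using hq.le
  have h := Real.log_le_sub_one_of_pos (div_pos hq hp)
  rw [Real.log_div hq.ne' hp.ne'] at h
  have h2 := mul_le_mul_of_nonneg_left h hp.le
  rw [mul_sub, mul_sub, mul_div_cancel₀ _ hp.ne'] at h2
  linarith

variable {n : Type*} [Fintype n] [DecidableEq n]

/-- The weights are squared overlaps of two orthonormal bases; they form a doubly stochastic matrix.
-/
theorem conj_spectralAlgHom_diag (V W : unitaryGroup n ℂ) (p : n → ℝ) (j : n) :
    (((V : Matrix n n ℂ)ᴴ * spectralAlgHom W p * V) j j).re =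
      ∑ i, Complex.normSq ((V⁻¹ * W : unitaryGroup n ℂ) j i) * p i := by
  have : (V : Matrix n n ℂ)ᴴ * spectralAlgHom W p * V = spectralAlgHom (V⁻¹ * W) p := by
    rw [← conj_spectralAlgHom]
    simp [star_eq_conjTranspose]
  rw [this, spectralAlgHom_apply, Matrix.mul_apply, Complex.re_sum]
  refine Finset.sum_congr rfl fun i _ => ?_
  rw [mul_diagonal, conjTranspose_apply, mul_right_comm, Complex.star_def, Complex.mul_conj,
    ← Complex.ofReal_mul, Complex.ofReal_re]

theorem sum_normSq_row (V : unitaryGroup n ℂ) (j : n) : ∑ i, Complex.normSq (V j i) = 1 := by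
  have h := congrFun (congrFun (mem_unitaryGroup_iff.1 V.2) j) j
  rw [Matrix.mul_apply, one_apply_eq] at h
  simp only [star_apply, Complex.star_def, Complex.mul_conj] at h
  exact_mod_cast h

theorem sum_normSq_col (V : unitaryGroup n ℂ) (i : n) : ∑ j, Complex.normSq (V j i) = 1 := by
  have h := congrFun (congrFun (mem_unitaryGroup_iff'.1 V.2) i) i
  rw [Matrix.mul_apply, one_apply_eq] at h
  simp only [star_apply, Complex.star_def, mul_comm _ (V.1 _ _), Complex.mul_conj] at h
  exact_mod_cast h

/-- Klein's inequality, for a state `ρ` and the state with eigenvalues `q` in the basis `V`. -/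
theorem IsDensityMatrix.sum_diag_mul_log_le {ρ : Matrix n n ℂ} (hρ : IsDensityMatrix ρ)
    (V : unitaryGroup n ℂ) {q : n → ℝ} (hq : ∀ i, 0 ≤ q i) (hsum : ∑ i, q i = 1)
    (hker : ∀ j, q j = 0 → (((V : Matrix n n ℂ)ᴴ * ρ * V) j j).re = 0) :
    ∑ j, (((V : Matrix n n ℂ)ᴴ * ρ * V) j j).re * Real.log (q j) ≤ -vonNeumannEntropy ρ := by
  obtain ⟨W, p, rfl, hp, hps⟩ := hρ.exists_eq_spectralAlgHom
  rw [vonNeumannEntropy_spectralAlgHom, neg_neg]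
  simp only [conj_spectralAlgHom_diag] at hker ⊢
  set w : n → n → ℝ := fun j i => Complex.normSq ((V⁻¹ * W : unitaryGroup n ℂ) j i)
  have hw : ∀ j i, 0 ≤ w j i := fun _ _ => Complex.normSq_nonneg _
  have hrow : ∀ j, ∑ i, w j i = 1 := sum_normSq_row _
  have hcol : ∀ i, ∑ j, w j i = 1 := sum_normSq_col _
  have key : ∀ j i, w j i * p i - w j i * q j ≤
      w j i * (p i * Real.log (p i)) - w j i * p i * Real.log (q j) := by
    intro j i
    rcases (hq j).eq_or_lt with h | h
    · have h0 := (Finset.sum_eq_zero_iff_of_nonneg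
        (fun i _ => mul_nonneg (hw j i) (hp i))).1 (hker j h.symm) i (Finset.mem_univ i)
      rw [← mul_assoc, h0, ← h]
      simp
    · have := mul_le_mul_of_nonneg_left (sub_le_mul_log_sub_log (hp i) h) (hw j i)
      linarith
  have hall := Finset.sum_le_sum fun j (_ : j ∈ Finset.univ) =>
    Finset.sum_le_sum fun i (_ : i ∈ Finset.univ) => key j i
  have hcolsum : ∀ f : n → ℝ, ∑ j, ∑ i, w j i * f i = ∑ i, f i := fun f => by
    rw [Finset.sum_comm]
    simp only [← Finset.sum_mul, hcol, one_mul]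
  -- By double stochasticity the left side sums to `∑ p - ∑ q = 0`.
  simp only [Finset.sum_sub_distrib, hcolsum, ← Finset.sum_mul, hrow, one_mul, hps, hsum] at hall
  linarith

end Klein

/-! ### Partial traces, product states and subadditivity -/

section PartialTrace

theorem partialTraceSnd_kronecker {m b : Type*} [Fintype b] (A : Matrix m m ℂ) (C : Matrix b b ℂ) :
    partialTraceSnd (A ⊗ₖ C) = C.trace • A := by
  ext i j
  simp [partialTraceSnd, trace, Finset.mul_sum, mul_comm]

theorem partialTraceFst_kronecker {m b : Type*} [Fintype m] (A : Matrix m m ℂ) (C : Matrix b b ℂ) :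
    partialTraceFst (A ⊗ₖ C) = A.trace • C := by
  ext i j
  simp [partialTraceFst, trace, Finset.sum_mul]

variable {m b : Type*} [Fintype m] [Fintype b]

theorem trace_partialTraceSnd (X : Matrix (m × b) (m × b) ℂ) :
    (partialTraceSnd X).trace = X.trace := by
  simp [partialTraceSnd, trace, Fintype.sum_prod_type]

theorem trace_partialTraceFst (X : Matrix (m × b) (m × b) ℂ) :
    (partialTraceFst X).trace = X.trace := by
  simp [partialTraceFst, trace, Fintype.sum_prod_type_right]

theorem trace_kronecker_one_mul [DecidableEq b] (A : Matrix m m ℂ)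
    (X : Matrix (m × b) (m × b) ℂ) :
    ((A ⊗ₖ (1 : Matrix b b ℂ)) * X).trace = (A * partialTraceSnd X).trace := by
  simp only [trace, diag_apply, Matrix.mul_apply, partialTraceSnd, of_apply, kroneckerMap_apply,
    Fintype.sum_prod_type, one_apply, mul_ite, mul_one, mul_zero, ite_mul, zero_mul,
    Finset.sum_ite_eq, Finset.mem_univ, if_true, Finset.mul_sum]
  exact Finset.sum_congr rfl fun i _ => Finset.sum_comm

theorem trace_one_kronecker_mul [DecidableEq m] (A : Matrix b b ℂ)
    (X : Matrix (m × b) (m × b) ℂ) :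
    (((1 : Matrix m m ℂ) ⊗ₖ A) * X).trace = (A * partialTraceFst X).trace := by
  simp only [trace, diag_apply, Matrix.mul_apply, partialTraceFst, of_apply, kroneckerMap_apply,
    Fintype.sum_prod_type_right, one_apply, ite_mul, one_mul, zero_mul,
    Finset.sum_ite_eq, Finset.mem_univ, if_true, Finset.mul_sum]
  exact Finset.sum_congr rfl fun i _ => Finset.sum_comm

theorem IsDensityMatrix.partialTraceSnd {X : Matrix (m × b) (m × b) ℂ} (hX : IsDensityMatrix X) :
    IsDensityMatrix (partialTraceSnd X) := by
  refine ⟨?_, by rw [trace_partialTraceSnd, hX.2]⟩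
  -- A sum of principal submatrices inherits positivity.
  have : _root_.partialTraceSnd X = ∑ k, X.submatrix (fun i => (i, k)) (fun i => (i, k)) := by
    ext i j
    simp [_root_.partialTraceSnd, Matrix.sum_apply]
  rw [this]
  exact posSemidef_sum _ fun k _ => hX.1.submatrix _

theorem IsDensityMatrix.partialTraceFst {X : Matrix (m × b) (m × b) ℂ} (hX : IsDensityMatrix X) :
    IsDensityMatrix (partialTraceFst X) := by
  refine ⟨?_, by rw [trace_partialTraceFst, hX.2]⟩
  have : _root_.partialTraceFst X = ∑ k, X.submatrix (fun i => (k, i)) (fun i => (k, i)) := by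
    ext i j
    simp [_root_.partialTraceFst, Matrix.sum_apply]
  rw [this]
  exact posSemidef_sum _ fun k _ => hX.1.submatrix _

theorem isDensityMatrix_kronecker {ρ : Matrix m m ℂ} {σ : Matrix b b ℂ}
    (hρ : IsDensityMatrix ρ) (hσ : IsDensityMatrix σ) : IsDensityMatrix (ρ ⊗ₖ σ) :=
  ⟨hρ.1.kronecker hσ.1, by rw [trace_kronecker, hρ.2, hσ.2, one_mul]⟩

variable [DecidableEq m] [DecidableEq b]

theorem expectedEnergy_totalHamiltonian (HM : Matrix m m ℂ) (HB : Matrix b b ℂ)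
    (X : Matrix (m × b) (m × b) ℂ) :
    expectedEnergy (totalHamiltonian HM HB) X =
      expectedEnergy HM (partialTraceSnd X) + expectedEnergy HB (partialTraceFst X) := by
  rw [expectedEnergy, totalHamiltonian, Matrix.add_mul, trace_add, trace_kronecker_one_mul,
    trace_one_kronecker_mul, Complex.add_re]
  rfl

/-- The Kronecker product of two unitary matrices. -/
def kroneckerUnitary (V : unitaryGroup m ℂ) (W : unitaryGroup b ℂ) : unitaryGroup (m × b) ℂ :=
  ⟨(V : Matrix m m ℂ) ⊗ₖ (W : Matrix b b ℂ), kronecker_mem_unitary V.2 W.2⟩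

theorem spectralAlgHom_kronecker (V : unitaryGroup m ℂ) (W : unitaryGroup b ℂ) (f : m → ℝ)
    (g : b → ℝ) :
    spectralAlgHom V f ⊗ₖ spectralAlgHom W g =
      spectralAlgHom (kroneckerUnitary V W) fun x => f x.1 * g x.2 := by
  simp only [spectralAlgHom_apply, kroneckerUnitary, conjTranspose_kronecker, mul_kronecker_mul,
    diagonal_kronecker_diagonal, Complex.ofReal_mul]

theorem vonNeumannEntropy_kronecker {ρ : Matrix m m ℂ} {σ : Matrix b b ℂ}
    (hρ : IsDensityMatrix ρ) (hσ : IsDensityMatrix σ) :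
    vonNeumannEntropy (ρ ⊗ₖ σ) = vonNeumannEntropy ρ + vonNeumannEntropy σ := by
  obtain ⟨V, p, rfl, -, hps⟩ := hρ.exists_eq_spectralAlgHom
  obtain ⟨W, q, rfl, -, hqs⟩ := hσ.exists_eq_spectralAlgHom
  rw [spectralAlgHom_kronecker]
  simp only [vonNeumannEntropy_spectralAlgHom, Fintype.sum_prod_type]
  have h : ∀ i j, p i * q j * Real.log (p i * q j) =
      p i * Real.log (p i) * q j + p i * (q j * Real.log (q j)) := by
    intro i j
    by_cases hi : p i = 0
    · simp [hi]
    by_cases hj : q j = 0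
    · simp [hj]
    rw [Real.log_mul hi hj]
    ring
  simp only [h, Finset.sum_add_distrib, ← Finset.mul_sum, ← Finset.sum_mul, hps, hqs]
  ring

theorem vonNeumannEntropy_unitary_conj {ρ : Matrix m m ℂ} (hρ : ρ.IsHermitian)
    {U : Matrix m m ℂ} (hU : U ∈ unitaryGroup m ℂ) :
    vonNeumannEntropy (U * ρ * Uᴴ) = vonNeumannEntropy ρ := by
  obtain ⟨V, hV⟩ := hρ.exists_eq_spectralAlgHom
  rw [hV]
  have := conj_spectralAlgHom ⟨U, hU⟩ V hρ.eigenvalues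
  simp only at this
  rw [this, vonNeumannEntropy_spectralAlgHom, vonNeumannEntropy_spectralAlgHom]

theorem IsDensityMatrix.unitary_conj {ρ : Matrix m m ℂ} (hρ : IsDensityMatrix ρ)
    {U : Matrix m m ℂ} (hU : U ∈ unitaryGroup m ℂ) : IsDensityMatrix (U * ρ * Uᴴ) := by
  refine ⟨hρ.1.mul_mul_conjTranspose_same _, ?_⟩
  rw [trace_mul_cycle, ← star_eq_conjTranspose, mem_unitaryGroup_iff'.1 hU, one_mul, hρ.2]

/-- Subadditivity of the von Neumann entropy. -/
theorem IsDensityMatrix.mutualInformation_nonneg {X : Matrix (m × b) (m × b) ℂ}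
    (hX : IsDensityMatrix X) : 0 ≤ mutualInformation X := by
  obtain ⟨V, p, hV, hp, hps⟩ := hX.partialTraceSnd.exists_eq_spectralAlgHom
  obtain ⟨W, q, hW, hq, hqs⟩ := hX.partialTraceFst.exists_eq_spectralAlgHom
  -- The diagonal of `X` in the product of the marginals' eigenbases: a joint distribution with
  -- marginals `p` and `q`.
  set d : m × b → ℝ := fun x =>
    (((kroneckerUnitary V W : Matrix (m × b) (m × b) ℂ)ᴴ * X * kroneckerUnitary V W) x x).re with hd
  have hd0 : ∀ x, 0 ≤ d x := fun x =>
    (Complex.nonneg_iff.1 ((hX.1.conjTranspose_mul_mul_same _).diag_nonneg (i := x))).1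
  have hfst : ∀ f : m → ℝ, ∑ x, d x * f x.1 = ∑ i, p i * f i := by
    intro f
    have h := trace_mul_spectralAlgHom (kroneckerUnitary V W) X fun x => f x.1 * (1 : b → ℝ) x.2
    rw [← spectralAlgHom_kronecker, map_one, trace_mul_comm, trace_kronecker_one_mul, hV,
      ← map_mul, trace_spectralAlgHom, Complex.ofReal_re] at h
    simpa [hd, mul_comm] using h.symm
  have hsnd : ∀ f : b → ℝ, ∑ x, d x * f x.2 = ∑ i, q i * f i := by
    intro f
    have h := trace_mul_spectralAlgHom (kroneckerUnitary V W) X fun x => (1 : m → ℝ) x.1 * f x.2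
    rw [← spectralAlgHom_kronecker, map_one, trace_mul_comm, trace_one_kronecker_mul, hW,
      ← map_mul, trace_spectralAlgHom, Complex.ofReal_re] at h
    simpa [hd, mul_comm] using h.symm
  have hp0 : ∀ x, p x.1 = 0 → d x = 0 := by
    intro x hx
    -- Testing against an indicator: a null marginal forces the nonnegative joint weights above it
    -- to vanish.
    have h := hfst (Pi.single x.1 1)
    simp only [Pi.single_apply, mul_ite, mul_one, mul_zero, Finset.sum_ite_eq', Finset.mem_univ,
      if_true, hx] at h
    have h2 := (Finset.sum_eq_zero_iff_of_nonneg fun y _ => by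
      split_ifs
      exacts [hd0 y, le_rfl]).1 h x (Finset.mem_univ x)
    simpa using h2
  have hq0 : ∀ x, q x.2 = 0 → d x = 0 := by
    intro x hx
    have h := hsnd (Pi.single x.2 1)
    simp only [Pi.single_apply, mul_ite, mul_one, mul_zero, Finset.sum_ite_eq', Finset.mem_univ,
      if_true, hx] at h
    have h2 := (Finset.sum_eq_zero_iff_of_nonneg fun y _ => by
      split_ifs
      exacts [hd0 y, le_rfl]).1 h x (Finset.mem_univ x)
    simpa using h2
  -- Klein's inequality against the product of the marginals.
  have hklein := hX.sum_diag_mul_log_le (kroneckerUnitary V W) (q := fun x => p x.1 * q x.2)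
    (fun x => mul_nonneg (hp _) (hq _))
    (by simp only [Fintype.sum_prod_type, ← Finset.mul_sum, hqs, mul_one, hps])
    (fun x hx => (mul_eq_zero.1 hx).elim (hp0 x) (hq0 x))
  have hlog : ∀ x, d x * Real.log (p x.1 * q x.2) =
      d x * Real.log (p x.1) + d x * Real.log (q x.2) := by
    intro x
    by_cases h1 : p x.1 = 0
    · simp [hp0 x h1]
    by_cases h2 : q x.2 = 0
    · simp [hq0 x h2]
    rw [Real.log_mul h1 h2, mul_add]
  change ∑ x, d x * _ ≤ _ at hklein
  simp only [hlog, Finset.sum_add_distrib] at hklein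
  rw [hfst fun i => Real.log (p i), hsnd fun i => Real.log (q i)] at hklein
  rw [mutualInformation, hV, hW, vonNeumannEntropy_spectralAlgHom,
    vonNeumannEntropy_spectralAlgHom]
  linarith

end PartialTrace

/-! ### Thermal states and the Gibbs variational principle -/

section Thermal

variable {n : Type*} [Fintype n] [DecidableEq n]

/-- The diagonalization of the thermal state: its eigenvalues are the Boltzmann weights, with
free energy `-log Z`. -/
theorem thermalState_spectralAlgHom (β : ℝ) (V : unitaryGroup n ℂ) (h : n → ℝ) :
    thermalState β (spectralAlgHom V h) =
      spectralAlgHom V fun i => (∑ j, Real.exp (-β * h j))⁻¹ * Real.exp (-β * h i) := by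
  have h1 : -β • spectralAlgHom V h = spectralAlgHom V (-β • h) := (map_smul _ _ _).symm
  have h2 : (fun i => (∑ j, Real.exp (-β * h j))⁻¹ * Real.exp (-β * h i)) =
      (∑ j, Real.exp (-β * h j))⁻¹ • fun i => Real.exp (-β * h i) := rfl
  rw [thermalState, h1, exp_spectralAlgHom, trace_spectralAlgHom, h2, map_smul,
    ← Complex.ofReal_inv]
  rfl

variable [Nonempty n]

/-- For the thermal state `τ`: it is a state with trivial kernel, and
`ln τ = -β H - ln Z`. -/
theorem exists_thermalState_eq (β : ℝ) {H : Matrix n n ℂ} (hH : H.IsHermitian) :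
    ∃ V q, ∃ c : ℝ, thermalState β H = spectralAlgHom V q ∧ (∀ i, 0 < q i) ∧ ∑ i, q i = 1 ∧
      matrixLog (thermalState β H) = -β • H - c • (1 : Matrix n n ℂ) := by
  obtain ⟨V, hV⟩ := hH.exists_eq_spectralAlgHom
  set h := hH.eigenvalues
  set Z := ∑ j, Real.exp (-β * h j) with hZ
  have hZ0 : 0 < Z := Finset.sum_pos (fun _ _ => Real.exp_pos _) Finset.univ_nonempty
  refine ⟨V, fun i => Z⁻¹ * Real.exp (-β * h i), Real.log Z, ?_,
    fun i => mul_pos (inv_pos.2 hZ0) (Real.exp_pos _), ?_, ?_⟩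
  · rw [hV, thermalState_spectralAlgHom]
  · rw [← Finset.mul_sum, ← hZ, inv_mul_cancel₀ hZ0.ne']
  · rw [hV, thermalState_spectralAlgHom, matrixLog_spectralAlgHom, ← map_one (spectralAlgHom V),
      ← map_smul, ← map_smul, ← map_sub]
    congr 1
    funext i
    rw [Real.log_mul (inv_pos.2 hZ0).ne' (Real.exp_pos _).ne', Real.log_exp, Real.log_inv]
    simp only [Pi.sub_apply, Pi.smul_apply, Pi.one_apply, smul_eq_mul, mul_one]
    ring

theorem isDensityMatrix_thermalState (β : ℝ) {H : Matrix n n ℂ} (hH : H.IsHermitian) :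
    IsDensityMatrix (thermalState β H) := by
  obtain ⟨V, q, c, h, hq, hqs, -⟩ := exists_thermalState_eq β hH
  rw [h]
  exact isDensityMatrix_spectralAlgHom V (fun i => (hq i).le) hqs

/-- The constant `ln Z` cancels because both states have trace one. -/
theorem trace_mul_matrixLog_thermalState_sub (β : ℝ) {H : Matrix n n ℂ} (hH : H.IsHermitian)
    {ρ : Matrix n n ℂ} (hρ : IsDensityMatrix ρ) :
    (ρ * matrixLog (thermalState β H)).trace.re + vonNeumannEntropy (thermalState β H) =
      -β * (expectedEnergy H ρ - expectedEnergy H (thermalState β H)) := by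
  obtain ⟨V, q, c, -, -, -, hlog⟩ := exists_thermalState_eq β hH
  have key : ∀ σ : Matrix n n ℂ, σ.trace = 1 →
      (σ * matrixLog (thermalState β H)).trace.re = -β * expectedEnergy H σ - c := by
    intro σ hσ
    rw [hlog, Matrix.mul_sub, trace_sub, Matrix.mul_smul, Matrix.mul_smul, trace_smul, trace_smul,
      Matrix.mul_one, hσ, trace_mul_comm, Complex.sub_re, Complex.smul_re, Complex.smul_re,
      expectedEnergy]
    simp
  rw [vonNeumannEntropy, key ρ hρ.2, key _ (isDensityMatrix_thermalState β hH).2]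
  ring

theorem relativeEntropy_thermalState {β : ℝ} (hβ : 0 < β) {H : Matrix n n ℂ} (hH : H.IsHermitian)
    {ρ : Matrix n n ℂ} (hρ : IsDensityMatrix ρ) :
    relativeEntropy ρ (thermalState β H) =
      ((β * (freeEnergy β H ρ - freeEnergy β H (thermalState β H)) : ℝ) : EReal) := by
  obtain ⟨V, q, c, hV, hq, -, -⟩ := exists_thermalState_eq β hH
  -- All Boltzmann weights are positive, so the thermal state is invertible and the relative entropy
  -- is finite.
  have hker : LinearMap.ker (thermalState β H).mulVecLin ≤ LinearMap.ker ρ.mulVecLin := by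
    have hinv : spectralAlgHom V q⁻¹ * thermalState β H = 1 := by
      rw [hV, ← map_mul, ← map_one (spectralAlgHom V)]
      congr 1
      funext i
      simp [(hq i).ne']
    intro x hx
    rw [LinearMap.mem_ker, mulVecLin_apply] at hx
    have : x = 0 := by rw [← one_mulVec x, ← hinv, ← mulVec_mulVec, hx, mulVec_zero]
    simp [this]
  rw [relativeEntropy, if_pos hker]
  congr 1
  have h := trace_mul_matrixLog_thermalState_sub β hH hρ
  rw [Matrix.mul_sub, trace_sub, Complex.sub_re, ← neg_neg (ρ * matrixLog ρ).trace.re,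
    ← vonNeumannEntropy, freeEnergy, freeEnergy]
  field_simp
  linarith

/-- Klein's inequality in the thermal eigenbasis, where the kernel condition is vacuous. -/
theorem freeEnergy_thermalState_le {β : ℝ} (hβ : 0 < β) {H : Matrix n n ℂ} (hH : H.IsHermitian)
    {ρ : Matrix n n ℂ} (hρ : IsDensityMatrix ρ) :
    freeEnergy β H (thermalState β H) ≤ freeEnergy β H ρ := by
  have h := trace_mul_matrixLog_thermalState_sub β hH hρ
  obtain ⟨V, q, c, hV, hq, hqs, -⟩ := exists_thermalState_eq β hH
  have hk := hρ.sum_diag_mul_log_le V (fun i => (hq i).le) hqs fun j hj => absurd hj (hq j).ne'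
  rw [← trace_mul_spectralAlgHom V ρ fun j => Real.log (q j), ← matrixLog_spectralAlgHom, ← hV]
    at hk
  have h2 : 0 ≤ β * (freeEnergy β H ρ - freeEnergy β H (thermalState β H)) := by
    rw [freeEnergy, freeEnergy]
    field_simp
    linarith
  exact sub_nonneg.1 (nonneg_of_mul_nonneg_right h2 hβ)

end Thermal

/-! ### The energy balance of the reset -/

theorem mainTheorem5 {M B : Type*} [Fintype M] [DecidableEq M]
    [Fintype B] [DecidableEq B] [Nonempty B]
    -- inverse temperature and Hamiltonians of memory and bath
    (β : ℝ) (hβ : 0 < β)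
    (HM : Matrix M M ℂ) (hHM : HM.IsHermitian)
    (HB : Matrix B B ℂ) (hHB : HB.IsHermitian)
    -- the state of the memory before the reset and the thermal state of the bath
    (ρM' : Matrix M M ℂ) (hρM' : IsDensityMatrix ρM')
    (ρB' : Matrix B B ℂ) (hρB' : ρB' = thermalState β HB)
    -- the joint initial state
    (ρMB' : Matrix (M × B) (M × B) ℂ) (hρMB' : ρMB' = ρM' ⊗ₖ ρB')
    -- the unitary of the resetting step and the joint final state
    (U : Matrix (M × B) (M × B) ℂ) (hU : U ∈ Matrix.unitaryGroup (M × B) ℂ)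
    (ρMB'' : Matrix (M × B) (M × B) ℂ) (hρMB'' : ρMB'' = U * ρMB' * Uᴴ)
    -- the memory is reset to the state `ρM`; `ρB''` is the final state of the bath
    (ρM : Matrix M M ℂ) (hreset : partialTraceSnd ρMB'' = ρM)
    (ρB'' : Matrix B B ℂ) (hρB'' : ρB'' = partialTraceFst ρMB'')
    -- energy cost and free energy changes
    (ΔE ΔFM ΔFB : ℝ)
    (hΔE : ΔE = expectedEnergy (totalHamiltonian HM HB) (ρMB'' - ρMB'))
    (hΔFM : ΔFM = freeEnergy β HM ρM' - freeEnergy β HM ρM)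
    (hΔFB : ΔFB = freeEnergy β HB ρB'' - freeEnergy β HB ρB') :
    β * ΔE = -(β * ΔFM) + β * ΔFB + mutualInformation ρMB'' ∧
      relativeEntropy ρB'' ρB' = ((β * ΔFB : ℝ) : EReal) ∧
      0 ≤ ΔFB ∧
      0 ≤ mutualInformation ρMB'' ∧
      -ΔFM ≤ ΔE := by

  have hρB : IsDensityMatrix ρB' := hρB' ▸ isDensityMatrix_thermalState β hHB
  have hprod : IsDensityMatrix ρMB' := hρMB' ▸ isDensityMatrix_kronecker hρM' hρB
  have hfinal : IsDensityMatrix ρMB'' := hρMB'' ▸ hprod.unitary_conj hU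
  have hρBf : IsDensityMatrix ρB'' := hρB'' ▸ hfinal.partialTraceFst
  have hS : vonNeumannEntropy ρMB'' = vonNeumannEntropy ρM' + vonNeumannEntropy ρB' := by
    rw [hρMB'', vonNeumannEntropy_unitary_conj hprod.1.1 hU, hρMB',
      vonNeumannEntropy_kronecker hρM' hρB]
  have hE : ΔE = expectedEnergy HM ρM + expectedEnergy HB ρB'' -
      (expectedEnergy HM ρM' + expectedEnergy HB ρB') := by
    have hsub : expectedEnergy (totalHamiltonian HM HB) (ρMB'' - ρMB') =
        expectedEnergy (totalHamiltonian HM HB) ρMB'' -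
          expectedEnergy (totalHamiltonian HM HB) ρMB' := by
      simp only [expectedEnergy, Matrix.mul_sub, trace_sub, Complex.sub_re]
    rw [hΔE, hsub, expectedEnergy_totalHamiltonian, expectedEnergy_totalHamiltonian, hreset,
      ← hρB'', hρMB', partialTraceSnd_kronecker, partialTraceFst_kronecker, hρB.2, hρM'.2,
      one_smul, one_smul]
  have hI : 0 ≤ mutualInformation ρMB'' := hfinal.mutualInformation_nonneg
  have hF : 0 ≤ ΔFB := by
    rw [hΔFB, hρB']
    exact sub_nonneg.2 (freeEnergy_thermalState_le hβ hHB hρBf)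
  have hbalance : β * ΔE = -(β * ΔFM) + β * ΔFB + mutualInformation ρMB'' := by
    rw [mutualInformation, hS, hreset, ← hρB'', hΔFM, hΔFB, hE]
    simp only [freeEnergy]
    field_simp
    ring
  refine ⟨hbalance, ?_, hF, hI, ?_⟩
  · rw [hΔFB, hρB']
    exact relativeEntropy_thermalState hβ hHB hρBf
  · refine le_of_mul_le_mul_left ?_ hβ
    have := mul_nonneg hβ.le hF
    linarith
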